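/- For a set $X$ of ordinals, say that $X$ is \emph{closed in its supremum} if $X\cap\sup X$ is closed in the ordinal $\sup X$ with its order topology, i.e. $X$ contains every limit point of $X$ below $\sup X$. For ordinals $\beta,\alpha_0,\alpha_1$ write $\beta\to^{cl}(\alpha_0,\alpha_1)^2$ if for every colouring $c$ of the $2$-element subsets of $\beta$ with colours $0,1$ there are $i\in\{0,1\}$ and $X\subseteq\beta$ of order type $\alpha_i$, closed in its supremum, all of whose $2$-element subsets have colour $i$. If such a $\beta$ exists, let $R^{cl}(\alpha_0,\alpha_1)$ denote the least one. \textbf{Proposition.} The closed ordinal Ramsey number $R^{cl}(\omega\cdot 2,3)$ exists, and \[R^{cl}(\omega\cdot 2,3)\le\omega^3\cdot 2.\] Moreover, every triangle-free graph with vertex set $\omega^3\cdot 2$ has an independent set of vertices which has order type $\omega\cdot 2$ and is closed in its supremum. -/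

import Mathlib

open Ordinal

universe u v

/-- The set of ordinals `X` has order type `α` and is closed in its supremum: `X` contains each of
its limit points below `sup X`, i.e. the trace of `X` on `{γ | γ < sup X}` is closed in the order
topology. (A set of elements of `Ordinal.{u}` has its order type in `Ordinal.{u + 1}`, hence the
`lift`.) -/
def IsClosedCopy (X : Set Ordinal.{u}) (α : Ordinal.{u}) : Prop :=
  typeLT X = Ordinal.lift.{u + 1} α ∧
    IsClosed {x : Set.Iio (sSup X) | (x : Ordinal.{u}) ∈ X}

/-- The closed partition relation `β →^cl (α i)^n_{i ∈ ι}`: for every colouring of the `n`-element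
subsets of `β` with colours in `ι`, there are a colour `i` and a set `X ⊆ β` of order type `α i`,
closed in its supremum, all of whose `n`-element subsets have colour `i`. -/
def ClosedArrow (β : Ordinal.{u}) {ι : Type v} (α : ι → Ordinal.{u}) (n : ℕ) : Prop :=
  ∀ col : {s : Finset (Set.Iio β) // s.card = n} → ι,
    ∃ (i : ι) (X : Set Ordinal.{u}), X ⊆ Set.Iio β ∧ IsClosedCopy X (α i) ∧
      ∀ s : {s : Finset (Set.Iio β) // s.card = n},
        (∀ x ∈ s.1, (x : Ordinal.{u}) ∈ X) → col s = i

/-- The closed ordinal Ramsey number `R^cl(α i)^n_{i ∈ ι}`: the least `β` with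
`β →^cl (α i)^n_{i ∈ ι}`. It is meaningful only if such a `β` exists. -/
noncomputable def closedRamseyNumber {ι : Type v} (α : ι → Ordinal.{u}) (n : ℕ) : Ordinal.{u} :=
  sInf {β : Ordinal.{u} | ClosedArrow β α n}

/-! For ultrafilters of ordinals write F → K if F-almost every x is adjacent to K-almost every y. In
a triangle-free graph F → K, F → L, K → L never hold together. Let F tend to q, a limit of a
sequence, and K to some δ > q. If none of q → F, q → K, F → K, K → F holds, a greedy choice gives a
closed independent copy of ω·2: a sequence tending to q, then q, then a sequence below δ
(`exists_isClosedCopy_isIndepSet`). So in a counterexample one of the four arrows always holds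
(`LimitsJoined`).

Let A_i and B_j, for i, j < 3, be generic points of ranks i and j below p = ω^3 and δ = ω^3·2. No
ultrafilter is joined to two of the A_i or to two of the B_j (`eq_of_almostJoined_generic`). Since
each triple p, A_i, B_j needs an arrow, counting forces p → A_i and p → B_j for some i, j and a
directed 4-cycle between the other A's and B's. Each value of i is refuted by descending to a rank 2
point near p and, where needed, to a rank 1 point near that. -/

open Filter Topology Set

/-! ### Closed copies of ω·2 -/

theorem typeLT_range_union_range {x z : ℕ → Ordinal.{u}} (hx : StrictMono x) (hz : StrictMono z)
    (hxz : ∀ n, x n < z 0) :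
    typeLT (range x ∪ range z : Set Ordinal.{u}) = Ordinal.lift.{u + 1} (ω * 2 : Ordinal.{u}) := by
  have hlt : ∀ m n, x m < z n := fun m n => (hxz m).trans_le (hz.monotone n.zero_le)
  let f : ℕ ⊕ ℕ → Ordinal.{u} := Sum.elim x z
  have hf : ∀ i j, f i < f j ↔ Sum.Lex (· < ·) (· < ·) i j := by
    rintro (i | i) (j | j) <;> simp [f, hx.lt_iff_lt, hz.lt_iff_lt, hlt, (hlt _ _).le]
  have hinj : Function.Injective f :=
    hx.injective.sumElim hz.injective fun m n => (hlt m n).ne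
  have hrange : range f = range x ∪ range z := Sum.elim_range x z
  rw [← hrange]
  let e : (Sum.Lex (· < ·) (· < ·) : ℕ ⊕ ℕ → ℕ ⊕ ℕ → Prop) ≃r
      ((· < ·) : range f → range f → Prop) :=
    ⟨Equiv.ofInjective f hinj, fun {i j} => hf i j⟩
  have h := (Ordinal.lift_type_eq.{0, u + 1, 0}).2 ⟨e⟩
  rw [type_sum_lex, type_nat_lt, Ordinal.lift_id'.{0, u + 1}] at h
  rw [← h, ← one_add_one_eq_two, mul_add, mul_one]
  simp

theorem isClosedCopy_range_union_range {x z : ℕ → Ordinal.{u}} (hx : StrictMono x)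
    (hz : StrictMono z) (hxz : ∀ n, x n < z 0) (hlim : Tendsto x atTop (𝓝 (z 0))) :
    IsClosedCopy (range x ∪ range z) (ω * 2 : Ordinal.{u}) := by
  refine ⟨typeLT_range_union_range hx hz hxz, ?_⟩
  rw [← isOpen_compl_iff, isOpen_iff_mem_nhds]
  rintro ⟨w, hw⟩ hwX
  have hwX : w ∉ range x ∪ range z := hwX
  obtain ⟨v, hv, hwv⟩ := exists_lt_of_lt_csSup ⟨x 0, .inl ⟨0, rfl⟩⟩ (mem_Iio.1 hw)
  obtain ⟨n, hn⟩ : ∃ n, w < z n := by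
    rcases hv with ⟨n, rfl⟩ | ⟨n, rfl⟩
    · exact ⟨0, hwv.trans (hxz n)⟩
    · exact ⟨n, hwv⟩
  -- Below `z n` the set is a convergent sequence with its limit and finitely many further points,
  -- hence closed.
  have hC : IsClosed (insert (z 0) (range x) ∪ z '' (Iic n)) :=
    hlim.isCompact_insert_range.isClosed.union ((finite_Iic n).image z).isClosed
  have hO : IsOpen (Iio (z n) ∩ (insert (z 0) (range x) ∪ z '' (Iic n))ᶜ) :=
    isOpen_Iio.inter hC.isOpen_compl
  have hmem : w ∈ Iio (z n) ∩ (insert (z 0) (range x) ∪ z '' (Iic n))ᶜ := by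
    refine ⟨hn, ?_⟩
    rintro ((rfl | h) | ⟨m, -, rfl⟩)
    · exact hwX (.inr ⟨0, rfl⟩)
    · exact hwX (.inl h)
    · exact hwX (.inr ⟨m, rfl⟩)
  refine mem_of_superset ((hO.preimage continuous_subtype_val).mem_nhds hmem) ?_
  rintro ⟨t, ht⟩ ⟨htn, htC⟩ (htx | ⟨m, hm⟩)
  · exact htC (.inl (.inr htx))
  · have hm : z m = t := hm
    refine htC (.inr ⟨m, ?_, hm⟩)
    have : z m < z n := hm ▸ htn
    exact (hz.lt_iff_lt.1 this).le

theorem isClosedCopy_of_finite {X : Set Ordinal.{u}} (hX : X.Finite) :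
    IsClosedCopy X (X.ncard : Ordinal.{u}) := by
  refine ⟨?_, hX.isClosed.preimage continuous_subtype_val⟩
  have := hX.fintype
  rw [type_fintype, ← Nat.card_eq_fintype_card, Nat.card_coe_set_eq, lift_natCast]

/-! ### From colourings to graphs -/

theorem closedArrow_of_graph {β α : Ordinal.{u}}
    (h : ∀ G : SimpleGraph (Iio β), G.CliqueFree 3 →
      ∃ X : Set Ordinal.{u}, X ⊆ Iio β ∧ IsClosedCopy X α ∧
        G.IsIndepSet {x | (x : Ordinal.{u}) ∈ X}) :
    ClosedArrow β ![α, 3] 2 := by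
  classical
  intro col
  let G : SimpleGraph (Iio β) :=
    { Adj := fun a b => ∃ hab : a ≠ b, col ⟨{a, b}, Finset.card_pair hab⟩ = 1
      symm := ⟨by
        rintro a b ⟨hab, hc⟩
        refine ⟨hab.symm, ?_⟩
        simpa only [Finset.pair_comm b a] using hc⟩
      loopless := ⟨fun a h => h.1 rfl⟩ }
  have hcol : ∀ a b (hab : a ≠ b) (s : {s : Finset (Iio β) // s.card = 2}),
      s.1 = {a, b} → (col s = 1 ↔ G.Adj a b) := by
    rintro a b hab ⟨s, hs⟩ rfl
    exact ⟨fun h => ⟨hab, h⟩, fun h => h.2⟩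
  by_cases hG : G.CliqueFree 3
  · obtain ⟨X, hXβ, hX, hind⟩ := h G hG
    refine ⟨0, X, hXβ, hX, fun s hs => ?_⟩
    obtain ⟨a, b, hab, hsab⟩ := Finset.card_eq_two.1 s.2
    have h1 : col s ≠ 1 := fun hc => by
      have hadj := (hcol a b hab s hsab).1 hc
      exact hind (hs a (by simp [hsab])) (hs b (by simp [hsab])) hab hadj
    exact (by decide : ∀ i : Fin 2, i ≠ 1 → i = 0) _ h1
  -- A triangle is a homogeneous set of colour 1, closed because it is finite.
  · simp only [SimpleGraph.CliqueFree, not_forall, not_not] at hG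
    obtain ⟨t, ht⟩ := hG
    refine ⟨1, Subtype.val '' (t : Set (Iio β)), ?_, ?_, fun s hs => ?_⟩
    · rintro _ ⟨a, -, rfl⟩
      exact a.2
    · have hc := isClosedCopy_of_finite ((t.finite_toSet).image (Subtype.val : Iio β → Ordinal.{u}))
      rw [ncard_image_of_injective _ Subtype.val_injective, ncard_coe_finset, ht.card_eq] at hc
      exact_mod_cast hc
    · obtain ⟨a, b, hab, hsab⟩ := Finset.card_eq_two.1 s.2
      refine (hcol a b hab s hsab).2 (ht.isClique ?_ ?_ hab)
      · obtain ⟨c, hc, hca⟩ := hs a (by simp [hsab])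
        rwa [← Subtype.val_injective hca]
      · obtain ⟨c, hc, hcb⟩ := hs b (by simp [hsab])
        rwa [← Subtype.val_injective hcb]

/-! ### Ultrafilters in triangle-free graphs, and their convergence -/

namespace SimpleGraph

variable {V : Type v} (H : SimpleGraph V)

/-- `F`-almost every vertex is joined to `K`-almost every vertex. -/
def AlmostJoined (F K : Ultrafilter V) : Prop :=
  ∀ᶠ x in (F : Filter V), ∀ᶠ y in (K : Filter V), H.Adj x y

variable {H}

theorem CliqueFree.not_adj_of_adj (hH : H.CliqueFree 3) {x y z : V} (hxy : H.Adj x y)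
    (hxz : H.Adj x z) : ¬ H.Adj y z := by
  classical
  exact fun hyz => hH {x, y, z} (is3Clique_triple_iff.2 ⟨hxy, hxz, hyz⟩)

theorem CliqueFree.not_almostJoined (hH : H.CliqueFree 3) {F K L : Ultrafilter V}
    (h₁ : H.AlmostJoined F K) (h₂ : H.AlmostJoined F L) : ¬ H.AlmostJoined K L := by
  intro h₃
  obtain ⟨x, hxK, hxL⟩ := (h₁.and h₂).exists
  obtain ⟨y, hxy, hyL⟩ := (hxK.and h₃).exists
  obtain ⟨z, hxz, hyz⟩ := (hxL.and hyL).exists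
  exact hH.not_adj_of_adj hxy hxz hyz

theorem CliqueFree.not_almostJoined_self (hH : H.CliqueFree 3) (F : Ultrafilter V) :
    ¬ H.AlmostJoined F F :=
  fun h => hH.not_almostJoined h h h

/-- Ultrafilter quantifiers commute with negation, so a missing arrow supplies generic non-adjacency
for the greedy choice. -/
theorem not_almostJoined_iff {F K : Ultrafilter V} :
    ¬ H.AlmostJoined F K ↔ ∀ᶠ x in (F : Filter V), ∀ᶠ y in (K : Filter V), ¬ H.Adj x y := by
  simp only [AlmostJoined, Ultrafilter.eventually_not]

end SimpleGraph

theorem Ultrafilter.bind_le_of_tendsto {ι : Type*} {U : Ultrafilter ι}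
    {F : ι → Ultrafilter Ordinal.{u}} {q : ι → Ordinal.{u}} {δ : Ordinal.{u}}
    (hF : ∀ n, (F n : Filter Ordinal.{u}) ≤ 𝓝[<] (q n)) (hq : Tendsto q U (𝓝[<] δ)) :
    (U.bind F : Filter Ordinal.{u}) ≤ 𝓝[<] δ := by
  intro s hs
  obtain ⟨O, hO, hδO, hOs⟩ := mem_nhdsWithin.1 hs
  have h1 : ∀ᶠ n in (U : Filter ι), q n ∈ O ∩ Iio δ :=
    hq (inter_mem (mem_nhdsWithin_of_mem_nhds (hO.mem_nhds hδO)) self_mem_nhdsWithin)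
  refine Filter.mem_bind'.2 (h1.mono fun n hn => hF n ?_)
  filter_upwards [mem_nhdsWithin_of_mem_nhds (hO.mem_nhds hn.1), self_mem_nhdsWithin] with w hw hwq
  exact hOs ⟨hw, mem_Iio.2 (lt_trans (mem_Iio.1 hwq) (mem_Iio.1 hn.2))⟩

theorem Ordinal.tendsto_add_mul_nat (β : Ordinal.{u}) {γ : Ordinal.{u}} (hγ : γ ≠ 0) :
    Tendsto (fun n : ℕ => β + γ * n) atTop (𝓝[<] (β + γ * ω)) := by
  have hpos : 0 < γ := pos_iff_ne_zero.2 hγ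
  have hlt : ∀ n : ℕ, β + γ * n < β + γ * ω := fun n =>
    add_lt_add_right (mul_lt_mul_of_pos_left (natCast_lt_omega0 n) hpos) β
  refine tendsto_nhdsWithin_iff.2 ⟨?_, .of_forall hlt⟩
  refine tendsto_atTop_isLUB (fun m n hmn => ?_) ⟨?_, ?_⟩
  · gcongr
  · rintro _ ⟨n, rfl⟩
    exact (hlt n).le
  · intro b hb
    by_contra! h
    obtain ⟨d, hd, hbd⟩ := (lt_add_iff (mul_ne_zero hγ omega0_ne_zero)).1 h
    obtain ⟨e, he, hde⟩ := (lt_mul_iff_of_isSuccLimit isSuccLimit_omega0).1 hd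
    obtain ⟨n, rfl⟩ := lt_omega0.1 he
    have := hb ⟨n, rfl⟩
    exact absurd (hbd.trans_lt (add_lt_add_right hde β)) this.not_gt

/-! ### Greedy construction of an independent copy -/

open SimpleGraph in
-- Pairs (x, y) are chosen recursively, x generic for F and y generic for K. Each new point avoids
-- the neighbours of q and of the earlier points, and itself has F-almost and K-almost no
-- neighbours, so the choice can go on.
theorem exists_isClosedCopy_isIndepSet {H : SimpleGraph Ordinal.{u}} (hH : H.CliqueFree 3)
    {q δ : Ordinal.{u}} {F K : Ultrafilter Ordinal.{u}} {v : ℕ → Ordinal.{u}}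
    (hv : Tendsto v atTop (𝓝[<] q)) (hqδ : q < δ)
    (hF : (F : Filter Ordinal.{u}) ≤ 𝓝[<] q) (hK : (K : Filter Ordinal.{u}) ≤ 𝓝[<] δ)
    (hqF : ¬ H.AlmostJoined (pure q) F) (hqK : ¬ H.AlmostJoined (pure q) K)
    (hFK : ¬ H.AlmostJoined F K) (hKF : ¬ H.AlmostJoined K F) :
    ∃ X ⊆ Iio δ, IsClosedCopy X (ω * 2) ∧ H.IsIndepSet X := by
  have hqF' : ∀ᶠ x in (F : Filter Ordinal.{u}), ¬ H.Adj q x := not_almostJoined_iff.1 hqF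
  have hqK' : ∀ᶠ x in (K : Filter Ordinal.{u}), ¬ H.Adj q x := not_almostJoined_iff.1 hqK
  have hFF := not_almostJoined_iff.1 (hH.not_almostJoined_self F)
  have hKK := not_almostJoined_iff.1 (hH.not_almostJoined_self K)
  rw [not_almostJoined_iff] at hFK hKF
  have ltF : ∀ w < q, ∀ᶠ x in (F : Filter Ordinal.{u}), w < x ∧ x < q := fun w hw =>
    hF (inter_mem (mem_nhdsWithin_of_mem_nhds (Ioi_mem_nhds hw)) self_mem_nhdsWithin)
  have ltK : ∀ w < δ, ∀ᶠ x in (K : Filter Ordinal.{u}), w < x ∧ x < δ := fun w hw =>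
    hK (inter_mem (mem_nhdsWithin_of_mem_nhds (Ioi_mem_nhds hw)) self_mem_nhdsWithin)
  obtain ⟨hvq, hvlt⟩ := tendsto_nhdsWithin_iff.1 hv
  -- The first component is an index into `v`; being above `v n` with n increasing is what makes the
  -- x's converge to q.
  let P : ℕ × Ordinal.{u} × Ordinal.{u} → Prop := fun t =>
    (v t.1 < t.2.1 ∧ t.2.1 < q ∧ q < t.2.2 ∧ t.2.2 < δ) ∧
    (¬ H.Adj q t.2.1 ∧ ¬ H.Adj q t.2.2 ∧ ¬ H.Adj t.2.1 t.2.2) ∧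
    (∀ᶠ x in (F : Filter Ordinal.{u}), ¬ H.Adj t.2.1 x ∧ ¬ H.Adj t.2.2 x) ∧
    ∀ᶠ y in (K : Filter Ordinal.{u}), ¬ H.Adj t.2.1 y ∧ ¬ H.Adj t.2.2 y
  let r : ℕ × Ordinal.{u} × Ordinal.{u} → ℕ × Ordinal.{u} × Ordinal.{u} → Prop := fun s t =>
    (s.1 < t.1 ∧ s.2.1 < t.2.1 ∧ s.2.2 < t.2.2) ∧
    (¬ H.Adj s.2.1 t.2.1 ∧ ¬ H.Adj s.2.2 t.2.1) ∧ ¬ H.Adj s.2.1 t.2.2 ∧ ¬ H.Adj s.2.2 t.2.2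
  obtain ⟨f, hfP, hfr⟩ := exists_seq_of_forall_finset_exists P r (by
    intro S hS
    obtain ⟨n, hn, hvn⟩ : ∃ n, (∀ s ∈ S, s.1 < n) ∧ v n < q := by
      have h1 : ∀ᶠ n in atTop, ∀ s ∈ S, s.1 < n :=
        (Finset.eventually_all S).2 fun s _ => eventually_gt_atTop s.1
      exact (h1.and hvlt).exists
    have hx : ∀ᶠ x in (F : Filter Ordinal.{u}), ∀ s ∈ S,
        s.2.1 < x ∧ ¬ H.Adj s.2.1 x ∧ ¬ H.Adj s.2.2 x :=
      (Finset.eventually_all S).2 fun s hs =>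
        ((ltF _ (hS s hs).1.2.1).mono fun _ h => h.1).and (hS s hs).2.2.1
    have hy : ∀ᶠ y in (K : Filter Ordinal.{u}), ∀ s ∈ S,
        s.2.2 < y ∧ ¬ H.Adj s.2.1 y ∧ ¬ H.Adj s.2.2 y :=
      (Finset.eventually_all S).2 fun s hs =>
        ((ltK _ (hS s hs).1.2.2.2).mono fun _ h => h.1).and (hS s hs).2.2.2
    obtain ⟨x, ⟨⟨hx, hxq⟩, hqx⟩, ⟨hxF, hxK⟩, hxS⟩ :=
      (((ltF _ hvn).and hqF').and ((hFF.and hFK).and hx)).exists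
    obtain ⟨y, ⟨⟨hy, hyδ⟩, hqy, hxy⟩, ⟨hyF, hyK⟩, hyS⟩ :=
      (((ltK _ hqδ).and (hqK'.and hxK)).and ((hKF.and hKK).and hy)).exists
    exact ⟨(n, x, y), ⟨⟨hx, hxq, hy, hyδ⟩, ⟨hqx, hqy, hxy⟩, hxF.and hyF, hxK.and hyK⟩,
      fun s hs => ⟨⟨hn s hs, (hxS s hs).1, (hyS s hs).1⟩, (hxS s hs).2, (hyS s hs).2⟩⟩)
  let x : ℕ → Ordinal.{u} := fun n => (f n).2.1
  let z : ℕ → Ordinal.{u} := fun n => Nat.casesOn n q fun m => (f m).2.2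
  have hx : StrictMono x := fun m n hmn => (hfr m n hmn).1.2.1
  have hz : StrictMono z := by
    rintro (_ | m) (_ | n) hmn
    · exact (lt_irrefl _ hmn).elim
    · exact (hfP n).1.2.2.1
    · exact (Nat.not_lt_zero _ hmn).elim
    · exact (hfr m n (Nat.lt_of_succ_lt_succ hmn)).1.2.2
  have hxq : ∀ n, x n < z 0 := fun n => (hfP n).1.2.1
  have hidx : StrictMono fun n => (f n).1 := fun m n hmn => (hfr m n hmn).1.1
  have hlim : Tendsto x atTop (𝓝 (z 0)) :=
    tendsto_of_tendsto_of_tendsto_of_le_of_le (hvq.comp hidx.tendsto_atTop) tendsto_const_nhds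
      (fun n => (hfP n).1.1.le) fun n => (hxq n).le
  refine ⟨range x ∪ range z, ?_, isClosedCopy_range_union_range hx hz hxq hlim, ?_⟩
  · rintro _ (⟨n, rfl⟩ | ⟨_ | n, rfl⟩)
    · exact (hxq n).trans hqδ
    · exact hqδ
    · exact (hfP n).1.2.2.2
  · have hxx : ∀ m n, ¬ H.Adj (x m) (x n) := fun m n => by
      rcases lt_trichotomy m n with h | rfl | h
      · exact (hfr m n h).2.1.1
      · exact H.irrefl
      · exact fun h' => (hfr n m h).2.1.1 h'.symm
    have hxz : ∀ m n, ¬ H.Adj (x m) (z n) := by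
      rintro m (_ | n)
      · exact fun h' => (hfP m).2.1.1 h'.symm
      · rcases lt_trichotomy m n with h | rfl | h
        · exact (hfr m n h).2.2.1
        · exact (hfP m).2.1.2.2
        · exact fun h' => (hfr n m h).2.1.2 h'.symm
    have hzz : ∀ m n, ¬ H.Adj (z m) (z n) := by
      rintro (_ | m) (_ | n)
      · exact H.irrefl
      · exact (hfP n).2.1.2.1
      · exact fun h' => (hfP m).2.1.2.1 h'.symm
      · rcases lt_trichotomy m n with h | rfl | h
        · exact (hfr m n h).2.2.2
        · exact H.irrefl
        · exact fun h' => (hfr n m h).2.2.2 h'.symm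
    rintro _ (⟨m, rfl⟩ | ⟨m, rfl⟩) _ (⟨n, rfl⟩ | ⟨n, rfl⟩) -
    · exact hxx m n
    · exact hxz m n
    · exact fun h' => hxz n m h'.symm
    · exact hzz m n

namespace SimpleGraph

/-- Below `κ`, whenever `F` converges to `q` and `K` converges to a larger point, both from below,
some two of `q`, `F`, `K` are almost joined. -/
def LimitsJoined (H : SimpleGraph Ordinal.{u}) (κ : Ordinal.{u}) : Prop :=
  ∀ ⦃q δ : Ordinal.{u}⦄ ⦃F K : Ultrafilter Ordinal.{u}⦄,
    (∃ v : ℕ → Ordinal.{u}, Tendsto v atTop (𝓝[<] q)) → q < δ → δ ≤ κ →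
    (F : Filter Ordinal.{u}) ≤ 𝓝[<] q → (K : Filter Ordinal.{u}) ≤ 𝓝[<] δ →
    H.AlmostJoined (pure q) F ∨ H.AlmostJoined (pure q) K ∨
      H.AlmostJoined F K ∨ H.AlmostJoined K F

theorem limitsJoined_of_forall_not {H : SimpleGraph Ordinal.{u}} (hH : H.CliqueFree 3)
    {κ : Ordinal.{u}} (h : ∀ X ⊆ Iio κ, IsClosedCopy X (ω * 2) → ¬ H.IsIndepSet X) :
    H.LimitsJoined κ := by
  rintro q δ F K ⟨v, hv⟩ hqδ hδ hF hK
  by_contra! hc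
  obtain ⟨X, hX, hcopy, hind⟩ :=
    exists_isClosedCopy_isIndepSet hH hv hqδ hF hK hc.1 hc.2.1 hc.2.2.1 hc.2.2.2
  exact h X (hX.trans (Iio_subset_Iio hδ)) hcopy hind

end SimpleGraph

/-! ### Generic points of ranks 0, 1, 2 -/

/-- Points of ranks `2`, `1`, `0` arranged below `δ` in iterated convergent sequences. -/
structure IteratedSequence (δ : Ordinal.{u}) where
  two : ℕ → Ordinal.{u}
  one : ℕ → ℕ → Ordinal.{u}
  zero : ℕ → ℕ → ℕ → Ordinal.{u}
  tendsto_two : Tendsto two atTop (𝓝[<] δ)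
  tendsto_one : ∀ a, Tendsto (one a) atTop (𝓝[<] (two a))
  tendsto_zero : ∀ a b, Tendsto (zero a b) atTop (𝓝[<] (one a b))

namespace IteratedSequence

variable {δ : Ordinal.{u}} (S : IteratedSequence δ)

/-- Generic points `zero a b c` close to `one a b`. -/
noncomputable def near (a b : ℕ) : Ultrafilter Ordinal.{u} := (hyperfilter ℕ).map (S.zero a b)

/-- Generic points `zero a b c` close to `two a`. -/
noncomputable def nearZero (a : ℕ) : Ultrafilter Ordinal.{u} := (hyperfilter ℕ).bind (S.near a)

/-- Generic points `one a b` close to `two a`. -/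
noncomputable def nearOne (a : ℕ) : Ultrafilter Ordinal.{u} := (hyperfilter ℕ).map (S.one a)

/-- Generic points of a given rank close to `δ`. -/
noncomputable def generic : Fin 3 → Ultrafilter Ordinal.{u} :=
  ![(hyperfilter ℕ).bind S.nearZero, (hyperfilter ℕ).bind S.nearOne, (hyperfilter ℕ).map S.two]

theorem near_le (a b : ℕ) : (S.near a b : Filter Ordinal.{u}) ≤ 𝓝[<] (S.one a b) :=
  (S.tendsto_zero a b).mono_left Nat.hyperfilter_le_atTop

theorem nearOne_le (a : ℕ) : (S.nearOne a : Filter Ordinal.{u}) ≤ 𝓝[<] (S.two a) :=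
  (S.tendsto_one a).mono_left Nat.hyperfilter_le_atTop

theorem nearZero_le (a : ℕ) : (S.nearZero a : Filter Ordinal.{u}) ≤ 𝓝[<] (S.two a) :=
  Ultrafilter.bind_le_of_tendsto (S.near_le a) (S.nearOne_le a)

theorem generic_le (i : Fin 3) : (S.generic i : Filter Ordinal.{u}) ≤ 𝓝[<] δ := by
  have h2 : Tendsto S.two (hyperfilter ℕ) (𝓝[<] δ) :=
    S.tendsto_two.mono_left Nat.hyperfilter_le_atTop
  fin_cases i
  · exact Ultrafilter.bind_le_of_tendsto S.nearZero_le h2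
  · exact Ultrafilter.bind_le_of_tendsto S.nearOne_le h2
  · exact h2

theorem eventually_two_lt : ∀ᶠ a in (hyperfilter ℕ : Filter ℕ), S.two a < δ :=
  S.generic_le 2 self_mem_nhdsWithin

theorem eventually_one_lt (a : ℕ) : ∀ᶠ b in (hyperfilter ℕ : Filter ℕ), S.one a b < S.two a :=
  S.nearOne_le a self_mem_nhdsWithin

variable {S}

open SimpleGraph

variable {H : SimpleGraph Ordinal.{u}} {κ : Ordinal.{u}}

/-- If i < j, some vertex v is joined to both generics, hence to a point q of rank j, to an
ultrafilter X of rank i points tending to q, and to K = `S.generic j`. Triangle-freeness then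
forbids all four arrows among q, X, K. -/
theorem eq_of_almostJoined_generic (hH : H.CliqueFree 3) (hT : H.LimitsJoined κ) (hδ : δ ≤ κ)
    {F : Ultrafilter Ordinal.{u}} {i j : Fin 3} (hi : H.AlmostJoined F (S.generic i))
    (hj : H.AlmostJoined F (S.generic j)) : i = j := by
  have key : ∀ {v q : Ordinal.{u}} {X K : Ultrafilter Ordinal.{u}}, H.AlmostJoined (pure v) X →
      H.Adj v q → H.AlmostJoined (pure v) K →
      ¬ (H.AlmostJoined (pure q) X ∨ H.AlmostJoined (pure q) K ∨
        H.AlmostJoined X K ∨ H.AlmostJoined K X) := by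
    rintro v q X K hX hq hK (h | h | h | h)
    · exact hH.not_almostJoined (F := pure v) (L := X) (K := pure q) hq hX h
    · exact hH.not_almostJoined (F := pure v) (L := K) (K := pure q) hq hK h
    · exact hH.not_almostJoined hX hK h
    · exact hH.not_almostJoined hK hX h
  wlog hij : i < j generalizing i j
  · rcases lt_or_eq_of_le (not_lt.1 hij) with h | h
    · exact (this hj hi h).symm
    · exact h.symm
  exfalso
  obtain ⟨v, hi, hj⟩ := (hi.and hj).exists
  change H.AlmostJoined (pure v) (S.generic i) at hi
  change H.AlmostJoined (pure v) (S.generic j) at hj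
  obtain ⟨rfl, rfl⟩ | ⟨rfl, rfl⟩ | ⟨rfl, rfl⟩ :
      (i = 0 ∧ j = 1) ∨ (i = 0 ∧ j = 2) ∨ (i = 1 ∧ j = 2) :=
    (by decide : ∀ i j : Fin 3, i < j →
      (i = 0 ∧ j = 1) ∨ (i = 0 ∧ j = 2) ∨ (i = 1 ∧ j = 2)) i j hij
  -- Quantifying over a `bind` is by definition an iterated quantifier, so such restatements need no
  -- proof.
  · have hi' : ∀ᶠ a in (hyperfilter ℕ : Filter ℕ), H.AlmostJoined (pure v) (S.nearZero a) := hi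
    have hj' : ∀ᶠ a in (hyperfilter ℕ : Filter ℕ), H.AlmostJoined (pure v) (S.nearOne a) := hj
    obtain ⟨a, ha, hia, hja⟩ := (S.eventually_two_lt.and (hi'.and hj')).exists
    have hia' : ∀ᶠ b in (hyperfilter ℕ : Filter ℕ), H.AlmostJoined (pure v) (S.near a b) := hia
    have hja' : ∀ᶠ b in (hyperfilter ℕ : Filter ℕ), H.Adj v (S.one a b) := hja
    obtain ⟨b, hb, hib, hjb⟩ := ((S.eventually_one_lt a).and (hia'.and hja')).exists
    exact key hib hjb hj
      (hT ⟨_, S.tendsto_zero a b⟩ (hb.trans ha) hδ (S.near_le a b) (S.generic_le 1))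
  · have hi' : ∀ᶠ a in (hyperfilter ℕ : Filter ℕ), H.AlmostJoined (pure v) (S.nearZero a) := hi
    have hj' : ∀ᶠ a in (hyperfilter ℕ : Filter ℕ), H.Adj v (S.two a) := hj
    obtain ⟨a, ha, hia, hja⟩ := (S.eventually_two_lt.and (hi'.and hj')).exists
    exact key hia hja hj (hT ⟨_, S.tendsto_one a⟩ ha hδ (S.nearZero_le a) (S.generic_le 2))
  · have hi' : ∀ᶠ a in (hyperfilter ℕ : Filter ℕ), H.AlmostJoined (pure v) (S.nearOne a) := hi
    have hj' : ∀ᶠ a in (hyperfilter ℕ : Filter ℕ), H.Adj v (S.two a) := hj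
    obtain ⟨a, ha, hia, hja⟩ := (S.eventually_two_lt.and (hi'.and hj')).exists
    exact key hia hja hj (hT ⟨_, S.tendsto_one a⟩ ha hδ (S.nearOne_le a) (S.generic_le 2))

end IteratedSequence

/-! ### Counting arrows -/

/-- Outside the exceptional row i and column j, the four entries of any 2 × 2 block are covered by
M, at most once per row, and N, at most once per column. Every bound is attained, which gives the
cycle. -/
theorem exists_four_cycle_of_at_most_one {P Q : Fin 3 → Prop} {M N : Fin 3 → Fin 3 → Prop}
    (hP : ∀ i j, P i → P j → i = j) (hQ : ∀ i j, Q i → Q j → i = j)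
    (hM : ∀ s i j, M s i → M s j → i = j) (hN : ∀ s i j, N s i → N s j → i = j)
    (h : ∀ i j, P i ∨ Q j ∨ M i j ∨ N j i) :
    ∃ i j, P i ∧ Q j ∧ ∀ s s', s ≠ s' → s ≠ i → s' ≠ i →
      ∃ t t', t ≠ t' ∧ t ≠ j ∧ t' ≠ j ∧ M s t ∧ N t s' ∧ M s' t' ∧ N t' s := by
  have aux : ∀ R : Fin 3 → Prop, (∀ i j, R i → R j → i = j) → ∃ i, ∀ j, j ≠ i → ¬ R j := by
    intro R hR
    by_cases hex : ∃ i, R i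
    · obtain ⟨i, hi⟩ := hex
      exact ⟨i, fun j hj hRj => hj (hR j i hRj hi)⟩
    · exact ⟨0, fun j _ hRj => hex ⟨j, hRj⟩⟩
  have others : ∀ i : Fin 3, ∃ s s', s ≠ s' ∧ s ≠ i ∧ s' ≠ i := by decide
  obtain ⟨i, hi⟩ := aux P hP
  obtain ⟨j, hj⟩ := aux Q hQ
  have cycle : ∀ s s', s ≠ s' → s ≠ i → s' ≠ i →
      ∃ t t', t ≠ t' ∧ t ≠ j ∧ t' ≠ j ∧ M s t ∧ N t s' ∧ M s' t' ∧ N t' s := by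
    intro s s' hs hsi hsi'
    obtain ⟨t, t', ht, htj, htj'⟩ := others j
    have h1 := h s t
    have h2 := h s t'
    have h3 := h s' t
    have h4 := h s' t'
    have := hi s hsi
    have := hi s' hsi'
    have := hj t htj
    have := hj t' htj'
    have := hM s t t'
    have := hM s' t t'
    have := hN t s s'
    have := hN t' s s'
    by_cases hst : M s t
    · exact ⟨t, t', ht, htj, htj', by grind⟩
    · exact ⟨t', t, ht.symm, htj', htj, by grind⟩
  obtain ⟨s, s', hs, hsi, hsi'⟩ := others i
  obtain ⟨t, t', ht, htj, htj', h1, h2, h3, h4⟩ := cycle s s' hs hsi hsi'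
  refine ⟨i, j, ?_, ?_, cycle⟩
  -- The cycle exhausts N in columns t and t', and M covers only one of (i, t), (i, t'), so P i must
  -- hold.
  · have ha := h i t
    have hb := h i t'
    have := hj t htj
    have := hj t' htj'
    have := hN t s' i h2
    have := hN t' s i h4
    have := hM i t t'
    grind
  · have ha := h s j
    have hb := h s' j
    have := hi s hsi
    have := hi s' hsi'
    have := hM s t j h1
    have := hM s' t' j h3
    have := hN j s s'
    grind

/-! ### Refuting the three configurations -/

namespace IteratedSequence

open SimpleGraph

variable {H : SimpleGraph Ordinal.{u}} {κ p δ : Ordinal.{u}}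
  {A : IteratedSequence p} {B : IteratedSequence δ}

/-- A generic rank 2 point q near p is forced to be joined to the rank 0 and rank 1 points near it.
For a rank 1 point r near q and the generic rank 0 points X near r, no arrow among r, X, `B.generic
t''` is then possible. -/
theorem false_of_joined_generic_zero (hH : H.CliqueFree 3) (hT : H.LimitsJoined κ) (hpδ : p < δ)
    (hδ : δ ≤ κ) {t t' t'' : Fin 3} (htt'' : t ≠ t'') (ht't'' : t' ≠ t'')
    (hpA : H.AlmostJoined (pure p) (A.generic 0)) (hpB : H.AlmostJoined (pure p) (B.generic t''))
    (h₁ : H.AlmostJoined (A.generic 1) (B.generic t))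
    (h₂ : H.AlmostJoined (A.generic 2) (B.generic t'))
    (h₃ : H.AlmostJoined (B.generic t') (A.generic 1)) : False := by
  have hpA' : ∀ᶠ a in (hyperfilter ℕ : Filter ℕ), H.AlmostJoined (pure p) (A.nearZero a) := hpA
  have h₁' : ∀ᶠ a in (hyperfilter ℕ : Filter ℕ), H.AlmostJoined (A.nearOne a) (B.generic t) := h₁
  have h₂' : ∀ᶠ a in (hyperfilter ℕ : Filter ℕ), H.AlmostJoined (pure (A.two a)) (B.generic t') :=
    h₂
  obtain ⟨a, hap, hp0, h1t, hqt'⟩ := (A.eventually_two_lt.and (hpA'.and (h₁'.and h₂'))).exists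
  have hq : ∃ v : ℕ → Ordinal.{u}, Tendsto v atTop (𝓝[<] (A.two a)) := ⟨_, A.tendsto_one a⟩
  have hq1 : H.AlmostJoined (pure (A.two a)) (A.nearOne a) := by
    rcases hT hq hap (hpδ.le.trans hδ) (A.nearOne_le a) (A.generic_le 1) with h | h | h | h
    · exact h
    · exact (hH.not_almostJoined hqt' h h₃).elim
    · exact (hH.not_almostJoined h h1t h₁).elim
    · exact (hH.not_almostJoined h h₁ h1t).elim
  have hq0 : H.AlmostJoined (pure (A.two a)) (A.nearZero a) := by
    rcases hT hq (hap.trans hpδ) hδ (A.nearZero_le a) (B.generic_le t'') with h | h | h | h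
    · exact h
    · exact (ht't'' (eq_of_almostJoined_generic hH hT hδ hqt' h)).elim
    · exact (hH.not_almostJoined hp0 hpB h).elim
    · exact (hH.not_almostJoined hpB hp0 h).elim
  have hp0' : ∀ᶠ b in (hyperfilter ℕ : Filter ℕ), H.AlmostJoined (pure p) (A.near a b) := hp0
  have hq0' : ∀ᶠ b in (hyperfilter ℕ : Filter ℕ),
    H.AlmostJoined (pure (A.two a)) (A.near a b) := hq0
  have hq1' : ∀ᶠ b in (hyperfilter ℕ : Filter ℕ),
    H.AlmostJoined (pure (A.two a)) (pure (A.one a b)) := hq1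
  have h1t' : ∀ᶠ b in (hyperfilter ℕ : Filter ℕ),
    H.AlmostJoined (pure (A.one a b)) (B.generic t) := h1t
  obtain ⟨b, hb, hpX, hqX, hqr, hrt⟩ :=
    ((A.eventually_one_lt a).and (hp0'.and (hq0'.and (hq1'.and h1t')))).exists
  rcases hT ⟨_, A.tendsto_zero a b⟩ (hb.trans (hap.trans hpδ)) hδ (A.near_le a b)
    (B.generic_le t'') with h | h | h | h
  · exact hH.not_almostJoined hqr hqX h
  · exact htt'' (eq_of_almostJoined_generic hH hT hδ hrt h)
  · exact hH.not_almostJoined hpX hpB h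
  · exact hH.not_almostJoined hpB hpX h

/-- Same descent with ranks 0 and 1 exchanged; the final contradiction is among r, X and `B.generic
t'`. -/
theorem false_of_joined_generic_one (hH : H.CliqueFree 3) (hT : H.LimitsJoined κ) (hpδ : p < δ)
    (hδ : δ ≤ κ) {t t' t'' : Fin 3} (htt' : t ≠ t') (ht't'' : t' ≠ t'')
    (hpA : H.AlmostJoined (pure p) (A.generic 1)) (hpB : H.AlmostJoined (pure p) (B.generic t''))
    (h₁ : H.AlmostJoined (A.generic 0) (B.generic t))
    (h₂ : H.AlmostJoined (A.generic 2) (B.generic t'))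
    (h₃ : H.AlmostJoined (B.generic t') (A.generic 0)) : False := by
  have hpA' : ∀ᶠ a in (hyperfilter ℕ : Filter ℕ), H.AlmostJoined (pure p) (A.nearOne a) := hpA
  have h₁' : ∀ᶠ a in (hyperfilter ℕ : Filter ℕ), H.AlmostJoined (A.nearZero a) (B.generic t) := h₁
  have h₂' : ∀ᶠ a in (hyperfilter ℕ : Filter ℕ), H.AlmostJoined (pure (A.two a)) (B.generic t') :=
    h₂
  obtain ⟨a, hap, hp1, h0t, hqt'⟩ := (A.eventually_two_lt.and (hpA'.and (h₁'.and h₂'))).exists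
  have hq : ∃ v : ℕ → Ordinal.{u}, Tendsto v atTop (𝓝[<] (A.two a)) := ⟨_, A.tendsto_one a⟩
  have hq1 : H.AlmostJoined (pure (A.two a)) (A.nearOne a) := by
    rcases hT hq (hap.trans hpδ) hδ (A.nearOne_le a) (B.generic_le t'') with h | h | h | h
    · exact h
    · exact (ht't'' (eq_of_almostJoined_generic hH hT hδ hqt' h)).elim
    · exact (hH.not_almostJoined hp1 hpB h).elim
    · exact (hH.not_almostJoined hpB hp1 h).elim
  have hq0 : H.AlmostJoined (pure (A.two a)) (A.nearZero a) := by
    rcases hT hq hap (hpδ.le.trans hδ) (A.nearZero_le a) (A.generic_le 0) with h | h | h | h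
    · exact h
    · exact (hH.not_almostJoined hqt' h h₃).elim
    · exact (hH.not_almostJoined h h0t h₁).elim
    · exact (hH.not_almostJoined h h₁ h0t).elim
  have h0t' : ∀ᶠ b in (hyperfilter ℕ : Filter ℕ), H.AlmostJoined (A.near a b) (B.generic t) := h0t
  have hq0' : ∀ᶠ b in (hyperfilter ℕ : Filter ℕ),
    H.AlmostJoined (pure (A.two a)) (A.near a b) := hq0
  have hq1' : ∀ᶠ b in (hyperfilter ℕ : Filter ℕ),
    H.AlmostJoined (pure (A.two a)) (pure (A.one a b)) := hq1
  obtain ⟨b, hb, hXt, hqX, hqr⟩ :=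
    ((A.eventually_one_lt a).and (h0t'.and (hq0'.and hq1'))).exists
  rcases hT ⟨_, A.tendsto_zero a b⟩ (hb.trans (hap.trans hpδ)) hδ (A.near_le a b)
    (B.generic_le t') with h | h | h | h
  · exact hH.not_almostJoined hqr hqX h
  · exact hH.not_almostJoined hqr hqt' h
  · exact htt' (eq_of_almostJoined_generic hH hT hδ hXt h)
  · exact hH.not_almostJoined hqt' hqX h

/-- Here only the 4-cycle is used. A rank 2 point q near p is joined, for each of the ranks 0 and 1,
to the points near q or to the points near p. If both times to those near q, a rank 1 point near q
gives the contradiction; otherwise the arrows around the cycle already do at q. -/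
theorem false_of_joined_generic_two (hH : H.CliqueFree 3) (hT : H.LimitsJoined κ) (hpδ : p < δ)
    (hδ : δ ≤ κ) {t t' : Fin 3} (htt' : t ≠ t')
    (h₁ : H.AlmostJoined (A.generic 0) (B.generic t))
    (h₂ : H.AlmostJoined (B.generic t) (A.generic 1))
    (h₃ : H.AlmostJoined (A.generic 1) (B.generic t'))
    (h₄ : H.AlmostJoined (B.generic t') (A.generic 0)) : False := by
  have hp : p ≤ κ := hpδ.le.trans hδ
  have h₁' : ∀ᶠ a in (hyperfilter ℕ : Filter ℕ), H.AlmostJoined (A.nearZero a) (B.generic t) := h₁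
  have h₃' : ∀ᶠ a in (hyperfilter ℕ : Filter ℕ), H.AlmostJoined (A.nearOne a) (B.generic t') := h₃
  obtain ⟨a, hap, h0t, h1t'⟩ := (A.eventually_two_lt.and (h₁'.and h₃')).exists
  have hq : ∃ v : ℕ → Ordinal.{u}, Tendsto v atTop (𝓝[<] (A.two a)) := ⟨_, A.tendsto_one a⟩
  have hq0 : H.AlmostJoined (pure (A.two a)) (A.nearZero a) ∨
      H.AlmostJoined (pure (A.two a)) (A.generic 0) := by
    rcases hT hq hap hp (A.nearZero_le a) (A.generic_le 0) with h | h | h | h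
    · exact .inl h
    · exact .inr h
    · exact (hH.not_almostJoined h h0t h₁).elim
    · exact (hH.not_almostJoined h h₁ h0t).elim
  have hq1 : H.AlmostJoined (pure (A.two a)) (A.nearOne a) ∨
      H.AlmostJoined (pure (A.two a)) (A.generic 1) := by
    rcases hT hq hap hp (A.nearOne_le a) (A.generic_le 1) with h | h | h | h
    · exact .inl h
    · exact .inr h
    · exact (hH.not_almostJoined h h1t' h₃).elim
    · exact (hH.not_almostJoined h h₃ h1t').elim
  have hnot : ¬ (H.AlmostJoined (pure (A.two a)) (A.generic 0) ∧
      H.AlmostJoined (pure (A.two a)) (A.generic 1)) := fun h =>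
    absurd (eq_of_almostJoined_generic hH hT hp h.1 h.2) (by decide)
  by_cases hq0n : H.AlmostJoined (pure (A.two a)) (A.nearZero a)
  · by_cases hq1n : H.AlmostJoined (pure (A.two a)) (A.nearOne a)
    · have h0t' : ∀ᶠ b in (hyperfilter ℕ : Filter ℕ),
        H.AlmostJoined (A.near a b) (B.generic t) := h0t
      have h1t'' : ∀ᶠ b in (hyperfilter ℕ : Filter ℕ),
        H.AlmostJoined (pure (A.one a b)) (B.generic t') := h1t'
      have hq0' : ∀ᶠ b in (hyperfilter ℕ : Filter ℕ),
        H.AlmostJoined (pure (A.two a)) (A.near a b) := hq0n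
      have hq1' : ∀ᶠ b in (hyperfilter ℕ : Filter ℕ),
        H.AlmostJoined (pure (A.two a)) (pure (A.one a b)) := hq1n
      obtain ⟨b, hb, hXt, hrt', hqX, hqr⟩ :=
        ((A.eventually_one_lt a).and (h0t'.and (h1t''.and (hq0'.and hq1')))).exists
      rcases hT ⟨_, A.tendsto_zero a b⟩ (hb.trans hap) hp (A.near_le a b)
        (A.generic_le 0) with h | h | h | h
      · exact hH.not_almostJoined hqr hqX h
      · exact hH.not_almostJoined hrt' h h₄
      · exact hH.not_almostJoined h hXt h₁
      · exact hH.not_almostJoined h h₁ hXt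
    · have hqA1 := hq1.resolve_left hq1n
      have ht1 : H.AlmostJoined (B.generic t) (A.nearOne a) := by
        rcases hT hq (hap.trans hpδ) hδ (A.nearOne_le a) (B.generic_le t) with h | h | h | h
        · exact (hq1n h).elim
        · exact (hH.not_almostJoined h hqA1 h₂).elim
        · exact (htt' (eq_of_almostJoined_generic hH hT hδ h h1t')).elim
        · exact h
      rcases hT hq hap hp (A.nearOne_le a) (A.generic_le 0) with h | h | h | h
      · exact hq1n h
      · exact hnot ⟨h, hqA1⟩
      · exact hH.not_almostJoined h1t' h h₄
      · exact hH.not_almostJoined h₁ h ht1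
  · have hqA0 := hq0.resolve_left hq0n
    have ht0 : H.AlmostJoined (B.generic t') (A.nearZero a) := by
      rcases hT hq (hap.trans hpδ) hδ (A.nearZero_le a) (B.generic_le t') with h | h | h | h
      · exact (hq0n h).elim
      · exact (hH.not_almostJoined h hqA0 h₄).elim
      · exact (htt' (eq_of_almostJoined_generic hH hT hδ h0t h)).elim
      · exact h
    rcases hT hq hap hp (A.nearZero_le a) (A.generic_le 1) with h | h | h | h
    · exact hq0n h
    · exact hnot ⟨hqA0, h⟩
    · exact hH.not_almostJoined h0t h h₂
    · exact hH.not_almostJoined h₃ h ht0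

theorem not_limitsJoined (A : IteratedSequence p) (B : IteratedSequence δ) (hH : H.CliqueFree 3)
    (hpδ : p < δ) (hδ : δ ≤ κ) : ¬ H.LimitsJoined κ := by
  intro hT
  have hp : p ≤ κ := hpδ.le.trans hδ
  obtain ⟨s'', t'', hpA, hpB, hcycle⟩ := exists_four_cycle_of_at_most_one
    (P := fun i => H.AlmostJoined (pure p) (A.generic i))
    (Q := fun j => H.AlmostJoined (pure p) (B.generic j))
    (M := fun i j => H.AlmostJoined (A.generic i) (B.generic j))
    (N := fun j i => H.AlmostJoined (B.generic j) (A.generic i))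
    (fun _ _ => eq_of_almostJoined_generic hH hT hp)
    (fun _ _ => eq_of_almostJoined_generic hH hT hδ)
    (fun _ _ _ => eq_of_almostJoined_generic hH hT hδ)
    (fun _ _ _ => eq_of_almostJoined_generic hH hT hp)
    (fun i j => hT ⟨_, A.tendsto_two⟩ hpδ hδ (A.generic_le i) (B.generic_le j))
  fin_cases s''
  · obtain ⟨t, t', -, ht, ht', h₁, -, h₂, h₃⟩ := hcycle 1 2 (by decide) (by decide) (by decide)
    exact false_of_joined_generic_zero hH hT hpδ hδ ht ht' hpA hpB h₁ h₂ h₃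
  · obtain ⟨t, t', htt', -, ht', h₁, -, h₂, h₃⟩ :=
      hcycle 0 2 (by decide) (by decide) (by decide)
    exact false_of_joined_generic_one hH hT hpδ hδ htt' ht' hpA hpB h₁ h₂ h₃
  · obtain ⟨t, t', htt', -, -, h₁, h₂, h₃, h₄⟩ := hcycle 0 1 (by decide) (by decide) (by decide)
    exact false_of_joined_generic_two hH hT hpδ hδ htt' h₁ h₂ h₃ h₄

/-- The points `β + ω ^ 2 * a + ω * b + c` and their limits below `β + ω ^ 3`. -/
noncomputable def omegaCubed (β : Ordinal.{u}) : IteratedSequence (β + ω ^ 3) where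
  -- The shift by one makes `two a` the limit of `one a b`, and `one a b` that of `zero a b c`; the
  -- factor in `1 * c` matches `tendsto_add_mul_nat`.
  two a := β + ω ^ 2 * (a + 1 : ℕ)
  one a b := β + ω ^ 2 * a + ω * (b + 1 : ℕ)
  zero a b c := β + ω ^ 2 * a + ω * b + 1 * c
  tendsto_two := by
    have h := (tendsto_add_mul_nat β (γ := ω ^ 2) (by simp)).comp (tendsto_add_atTop_nat 1)
    rwa [← pow_succ] at h
  tendsto_one a := by
    have h := (tendsto_add_mul_nat (β + ω ^ 2 * a) omega0_ne_zero).comp (tendsto_add_atTop_nat 1)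
    rwa [← pow_two, add_assoc, ← mul_add_one, ← Nat.cast_succ] at h
  tendsto_zero a b := by
    have h := tendsto_add_mul_nat (β + ω ^ 2 * a + ω * b) one_ne_zero
    rwa [one_mul, add_assoc _ (ω * _), ← mul_add_one, ← Nat.cast_succ] at h

end IteratedSequence

/-! ### Conclusion -/

theorem exists_isClosedCopy_isIndepSet_of_cliqueFree
    (G : SimpleGraph (Iio (ω ^ 3 * 2 : Ordinal.{u}))) (hG : G.CliqueFree 3) :
    ∃ X : Set Ordinal.{u}, X ⊆ Iio (ω ^ 3 * 2) ∧ IsClosedCopy X (ω * 2) ∧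
      G.IsIndepSet {x | (x : Ordinal.{u}) ∈ X} := by
  -- The graph is extended to all ordinals by isolated vertices, so that ultrafilters on `Ordinal`
  -- apply.
  have hH : (G.map (Function.Embedding.subtype _)).CliqueFree 3 := by
    have : Nonempty (Iio (ω ^ 3 * 2 : Ordinal.{u})) := ⟨0, by simp [pos_iff_ne_zero]⟩
    exact SimpleGraph.cliqueFree_map_iff.2 hG
  by_contra! hc
  refine (IteratedSequence.omegaCubed 0).not_limitsJoined (IteratedSequence.omegaCubed (ω ^ 3)) hH
    (by simp) (κ := ω ^ 3 * 2) (by rw [← one_add_one_eq_two, mul_add, mul_one])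
    (SimpleGraph.limitsJoined_of_forall_not hH fun X hX hcopy hind => hc X hX hcopy ?_)
  intro x hx y hy hxy hadj
  exact hind hx hy (Subtype.val_injective.ne hxy) ((SimpleGraph.map_adj _ _ _ _).2
    ⟨x, y, hadj, rfl, rfl⟩)

theorem mainTheorem2 :
    ({β : Ordinal.{u} | ClosedArrow β ![ω * 2, 3] 2}.Nonempty ∧
      closedRamseyNumber ![(ω * 2 : Ordinal.{u}), 3] 2 ≤ ω ^ 3 * 2) ∧
    ∀ G : SimpleGraph (Set.Iio (ω ^ 3 * 2 : Ordinal.{u})), G.CliqueFree 3 →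
      ∃ X : Set Ordinal.{u}, X ⊆ Set.Iio (ω ^ 3 * 2) ∧ IsClosedCopy X (ω * 2) ∧
        G.IsIndepSet {x | (x : Ordinal.{u}) ∈ X} := by
  have h : ClosedArrow (ω ^ 3 * 2 : Ordinal.{u}) ![ω * 2, 3] 2 :=
    closedArrow_of_graph exists_isClosedCopy_isIndepSet_of_cliqueFree
  exact ⟨⟨⟨_, h⟩, csInf_le' h⟩, exists_isClosedCopy_isIndepSet_of_cliqueFree⟩
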